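/- For a function $f$ on the torus $\mathbb T=\mathbb R/\mathbb Z$ (with Lebesgue measure of total mass $1$) and a positive integer $n$ let $R_nf(x)=\frac1n\sum_{k=0}^{n-1}f\left(x+\frac kn\right)$ be its Riemann sums. A chain is the set of terms of a strictly increasing sequence of positive integers in which each term divides the next one. For sets $\mathcal S_1,\dots,\mathcal S_d$ of positive integers, $[\mathcal S_1,\dots,\mathcal S_d]$ denotes the set of all least common multiples $\operatorname{lcm}(n_1,\dots,n_d)$ with $n_i\in\mathcal S_i$. The dimension of a set $\mathcal S$ of positive integers is the least integer $d\ge 1$ such that $\mathcal S\subset[\mathcal S_1,\dots,\mathcal S_d]$ for some chains $\mathcal S_1,\dots,\mathcal S_d$, and it is infinite if no such $d$ exists. There is an infinite set $E$ of positive integers, of infinite dimension, such that for every $p>1$ ($p=\infty$ allowed) and every complex-valued $f\in L^p(\mathbb T)$ the Riemann sums $R_nf(x)$, $n\in E$, converge almost everywhere, and their limit is the integral of $f$: $$\lim_{n\to\infty,\ n\in E}R_nf(x)=\int_{\mathbb T}f\quad\text{for almost every }x\in\mathbb T .$$ -/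

import Mathlib

open MeasureTheory Filter Topology

namespace RiemannSums

/-- The Riemann sum `R_n f(x) = (1/n) ∑_{k=0}^{n-1} f(x + k/n)` of a function on the
torus `𝕋 = ℝ/ℤ`. -/
noncomputable def riemannSum (n : ℕ) (f : UnitAddCircle → ℂ) (x : UnitAddCircle) : ℂ :=
  (1 / (n : ℂ)) * ∑ k ∈ Finset.range n, f (x + (((k : ℝ) / (n : ℝ) : ℝ) : UnitAddCircle))

/-- A chain: the set of terms of an increasing sequence of natural numbers `s 0 < s 1 < ⋯` in
which each term divides the next one. (All terms are then automatically positive.) -/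
def IsDivChain (S : Set ℕ) : Prop :=
  ∃ s : ℕ → ℕ, StrictMono s ∧ (∀ k, s k ∣ s (k + 1)) ∧ S = Set.range s

/-- `[S₁, …, S_d]`: the set of all least common multiples of numbers `n₁ ∈ S₁, …, n_d ∈ S_d`. -/
def lcmSet {d : ℕ} (S : Fin d → Set ℕ) : Set ℕ :=
  {n | ∃ m : Fin d → ℕ, (∀ i, m i ∈ S i) ∧ n = Finset.univ.lcm m}

/-- The dimension of a set of positive integers: the least `d ≥ 1` such that the set is contained
in `[S₁, …, S_d]` for some chains `S₁, …, S_d`, and `⊤` (infinite dimension) if there is no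
such `d`. -/
noncomputable def dimension (A : Set ℕ) : ℕ∞ :=
  sInf {D : ℕ∞ | ∃ d : ℕ, 1 ≤ d ∧ D = (d : ℕ∞) ∧
    ∃ S : Fin d → Set ℕ, (∀ i, IsDivChain (S i)) ∧ A ⊆ lcmSet S}

end RiemannSums

/-!
Write `R n` for the averaging operator `avg n`, the conditional expectation onto the functions with
period `1 / n`. These operators commute and `R a (R b f) = R (lcm a b) f` (`avg_avg`), so along a
divisibility chain `R n f` is a reverse martingale and Doob's inequality holds
(`exists_doob_const`). For infinite dimension one has to leave the sets `[S₁, …, S_d]`, for which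
Doob's inequality can be iterated.

*The set.* Attach distinct primes `q (a, b)` to the pairs `a < b` of natural numbers and group the
natural numbers into dyadic blocks. For a vertex `t` let `n t` (`starNum t`) be the product of the
`q (a, b)` with `b` before the end of the block of `t` and `t ∉ {a, b}`. If the numbers `n t` were
lcms of members of `d` chains, each block would carry `d` preorders such that, for all `s < t < u`
in it, some preorder places `t` strictly above both `s` and `u`: the prime `q (s, u)` divides `n t`
but neither `n s` nor `n u`. A pigeonhole argument excludes this in a large block
(`exists_monochromatic_path`), so the dimension is infinite (`dimension_range_starNum`).

*The maximal inequality.* Let `M t` be the product of the primes of the pairs with `b < t`, a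
divisibility chain with `M t ∣ n t`, and let `X t = R (M t) f`. Then
`R (n t) f = R (lcm (n t) (M (t + 1))) f + R (n t) (X t - X (t + 1))`.
In the first term the lcm is also the lcm of members of two fixed chains
(`chainControlled_starNum`), so Doob's inequality applied twice controls it. In the second term
split the jump `X t - X (t + 1)` according to whether it exceeds `l` times the maximal function `X*`
of the martingale. The small jumps contribute at most `l` times the maximal function of `X*` along
`n`, whose norm is at most `l` times the unknown best constant times the norm of `X*`; for small `l`
this is absorbed by the left-hand side. For the large jumps the `p`-th power of the jump is bounded
by a multiple of the Bregman divergence of `x ^ p` between the two values (`exists_bregman_const`),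
and the integrals of these divergences telescope (`integral_bregman_avg`). This gives an `L^p` bound
for every `1 < p < ∞`, uniform in the number of averages (`ChainControlled.exists_maximal_const`).

*Convergence.* For trigonometric polynomials `R n f` equals the integral for all large `n`, so for
continuous functions the Riemann sums converge everywhere; the maximal inequality extends this to
almost everywhere convergence on `L^p`.
-/

namespace RiemannSums

/-! ### Averages over the `n`-torsion points -/

/-- The average of `f` over the translates of `x` by the points `k / n`: the Riemann sum `R_n f (x)`
for functions with values in an arbitrary real vector space. -/
noncomputable def avg {F : Type*} [AddCommGroup F] [Module ℝ F] (n : ℕ)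
    (f : UnitAddCircle → F) (x : UnitAddCircle) : F :=
  (n : ℝ)⁻¹ • ∑ k ∈ Finset.range n, f (x + (((k : ℝ) / (n : ℝ) : ℝ) : UnitAddCircle))

theorem riemannSum_eq_avg (n : ℕ) (f : UnitAddCircle → ℂ) : riemannSum n f = avg n f := by
  funext x
  simp [riemannSum, avg]

theorem coe_div_eq_nsmul (k n : ℕ) :
    (((k : ℝ) / (n : ℝ) : ℝ) : UnitAddCircle) = k • ((1 / (n : ℝ) : ℝ) : UnitAddCircle) := by
  rw [← AddCircle.coe_nsmul]
  congr 1
  simp [div_eq_mul_inv]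

theorem periodic_of_dvd {X : Type*} {g : UnitAddCircle → X} {m n : ℕ} (hn : 0 < n) (hmn : m ∣ n)
    (hg : Function.Periodic g ((1 / (n : ℝ) : ℝ) : UnitAddCircle)) :
    Function.Periodic g ((1 / (m : ℝ) : ℝ) : UnitAddCircle) := by
  obtain ⟨c, rfl⟩ := hmn
  have h : ((1 / (m : ℝ) : ℝ) : UnitAddCircle) =
      c • ((1 / ((m * c : ℕ) : ℝ) : ℝ) : UnitAddCircle) := by
    rw [← coe_div_eq_nsmul]
    congr 1
    have hc : (c : ℝ) ≠ 0 := by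
      have := Nat.pos_of_mul_pos_left hn
      positivity
    push_cast
    field_simp
  rw [h]
  exact hg.nsmul c

section Algebra

variable {F : Type*} [AddCommGroup F] [Module ℝ F] {f g : UnitAddCircle → F} {n : ℕ}

theorem avg_add (n : ℕ) (f g : UnitAddCircle → F) : avg n (f + g) = avg n f + avg n g := by
  funext x
  simp [avg, Finset.sum_add_distrib]

theorem avg_sub (n : ℕ) (f g : UnitAddCircle → F) : avg n (f - g) = avg n f - avg n g := by
  funext x
  simp [avg, Finset.sum_sub_distrib, smul_sub]

theorem avg_smul (n : ℕ) (c : ℝ) (f : UnitAddCircle → F) : avg n (c • f) = c • avg n f := by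
  funext x
  simp [avg, ← Finset.smul_sum, smul_comm c]

theorem avg_comm (m n : ℕ) (f : UnitAddCircle → F) : avg m (avg n f) = avg n (avg m f) := by
  funext x
  simp only [avg, ← Finset.smul_sum]
  rw [Finset.sum_comm, smul_comm]
  simp only [add_right_comm]

theorem avg_periodic (hn : 0 < n) (f : UnitAddCircle → F) :
    Function.Periodic (avg n f) ((1 / (n : ℝ) : ℝ) : UnitAddCircle) := by
  intro x
  simp only [avg]
  congr 1
  have h : ∀ k : ℕ, x + ((1 / (n : ℝ) : ℝ) : UnitAddCircle) +
      (((k : ℝ) / (n : ℝ) : ℝ) : UnitAddCircle) =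
      x + ((((k + 1 : ℕ) : ℝ) / (n : ℝ) : ℝ) : UnitAddCircle) := by
    intro k
    rw [add_assoc, ← AddCircle.coe_add]
    congr 2
    push_cast
    ring
  simp only [h]
  have h1 := Finset.sum_range_succ
    (fun k : ℕ => f (x + (((k : ℝ) / (n : ℝ) : ℝ) : UnitAddCircle))) n
  rw [Finset.sum_range_succ'] at h1
  have hn' : (n : ℝ) ≠ 0 := by positivity
  simpa [hn', AddCircle.coe_period] using h1

theorem avg_of_periodic (hn : 0 < n)
    (hg : Function.Periodic g ((1 / (n : ℝ) : ℝ) : UnitAddCircle)) : avg n g = g := by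
  funext x
  have h : ∀ k : ℕ, g (x + (((k : ℝ) / (n : ℝ) : ℝ) : UnitAddCircle)) = g x := fun k => by
    rw [coe_div_eq_nsmul, hg.nsmul k x]
  have hn' : (n : ℝ) ≠ 0 := by positivity
  simp only [avg, h, Finset.sum_const, Finset.card_range, ← Nat.cast_smul_eq_nsmul ℝ]
  rw [smul_smul, inv_mul_cancel₀ hn', one_smul]

theorem avg_avg_of_dvd {m : ℕ} (hn : 0 < n) (hm : 0 < m) (hmn : m ∣ n) (f : UnitAddCircle → F) :
    avg n (avg m f) = avg n f := by
  rw [avg_comm]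
  exact avg_of_periodic hm (periodic_of_dvd hn hmn (avg_periodic hn f))

/-- The composition of two averages is periodic under `1 / a` and `1 / b`, hence by Bézout under
`1 / lcm a b`; averaging it once more over the `lcm a b`-torsion points changes nothing. -/
theorem avg_avg {a b : ℕ} (ha : 0 < a) (hb : 0 < b) (f : UnitAddCircle → F) :
    avg a (avg b f) = avg (Nat.lcm a b) f := by
  have hl : 0 < Nat.lcm a b := Nat.lcm_pos ha hb
  have hpa : Function.Periodic (avg a (avg b f)) ((1 / (a : ℝ) : ℝ) : UnitAddCircle) :=
    avg_periodic ha _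
  have hpb : Function.Periodic (avg a (avg b f)) ((1 / (b : ℝ) : ℝ) : UnitAddCircle) := by
    rw [avg_comm]
    exact avg_periodic hb _
  have hpl : Function.Periodic (avg a (avg b f))
      ((1 / ((Nat.lcm a b : ℕ) : ℝ) : ℝ) : UnitAddCircle) := by
    have h : ((1 / ((Nat.lcm a b : ℕ) : ℝ) : ℝ) : UnitAddCircle) =
        Nat.gcdB a b • ((1 / (a : ℝ) : ℝ) : UnitAddCircle) +
          Nat.gcdA a b • ((1 / (b : ℝ) : ℝ) : UnitAddCircle) := by
      rw [← AddCircle.coe_zsmul, ← AddCircle.coe_zsmul, ← AddCircle.coe_add]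
      congr 1
      have h1 : ((Nat.gcd a b : ℕ) : ℝ) * (Nat.lcm a b : ℕ) = a * b := by
        exact_mod_cast Nat.gcd_mul_lcm a b
      have h2 : ((Nat.gcd a b : ℕ) : ℝ) = a * (Nat.gcdA a b : ℝ) + b * (Nat.gcdB a b : ℝ) := by
        exact_mod_cast Nat.gcd_eq_gcd_ab a b
      have ha' : (a : ℝ) ≠ 0 := by positivity
      have hb' : (b : ℝ) ≠ 0 := by positivity
      have hl' : ((Nat.lcm a b : ℕ) : ℝ) ≠ 0 := by positivity
      rw [h2] at h1
      simp only [zsmul_eq_mul]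
      field_simp
      linarith
    rw [h]
    exact (hpa.zsmul _).add_period (hpb.zsmul _)
  rw [← avg_of_periodic hl hpl, avg_avg_of_dvd hl ha (Nat.dvd_lcm_left a b),
    avg_avg_of_dvd hl hb (Nat.dvd_lcm_right a b)]

end Algebra

theorem avg_mono {n : ℕ} {f g : UnitAddCircle → ℝ} (h : ∀ x, f x ≤ g x) (x : UnitAddCircle) :
    avg n f x ≤ avg n g x := by
  simp only [avg, smul_eq_mul]
  have := Finset.sum_le_sum fun k (_ : k ∈ Finset.range n) =>
    h (x + (((k : ℝ) / (n : ℝ) : ℝ) : UnitAddCircle))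
  gcongr

theorem avg_nonneg {n : ℕ} {f : UnitAddCircle → ℝ} (h : ∀ x, 0 ≤ f x) (x : UnitAddCircle) :
    0 ≤ avg n f x := by
  simp only [avg, smul_eq_mul]
  exact mul_nonneg (by positivity) (Finset.sum_nonneg fun k _ => h _)

theorem avg_const {n : ℕ} (hn : 0 < n) (c : ℝ) : avg n (fun _ => c) = fun _ => c :=
  avg_of_periodic hn fun _ => rfl

theorem norm_avg_le (n : ℕ) (f : UnitAddCircle → ℂ) (x : UnitAddCircle) :
    ‖avg n f x‖ ≤ avg n (fun y => ‖f y‖) x := by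
  simp only [avg, norm_smul, smul_eq_mul, norm_inv, RCLike.norm_natCast]
  gcongr
  exact norm_sum_le _ _

/-- Jensen's inequality for averages. -/
theorem avg_rpow_le {n : ℕ} (hn : 0 < n) {p : ℝ} (hp : 1 ≤ p) {f : UnitAddCircle → ℝ}
    (h : ∀ x, 0 ≤ f x) (x : UnitAddCircle) :
    avg n f x ^ p ≤ avg n (fun y => f y ^ p) x := by
  have hn' : (n : ℝ) ≠ 0 := by positivity
  have := Real.rpow_arith_mean_le_arith_mean_rpow (Finset.range n) (fun _ => (n : ℝ)⁻¹)
    (fun k => f (x + (((k : ℝ) / (n : ℝ) : ℝ) : UnitAddCircle)))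
    (fun _ _ => by positivity) (by simp [hn']) (fun _ _ => h _) hp
  simpa [avg, Finset.mul_sum] using this

theorem measurable_avg {n : ℕ} {f : UnitAddCircle → ℝ} (hf : Measurable f) :
    Measurable (avg n f) := by
  unfold avg
  simp only [smul_eq_mul]
  exact (Finset.measurable_fun_sum _ fun k _ => hf.comp (measurable_add_const _)).const_mul _

theorem integral_avg {F : Type*} [NormedAddCommGroup F] [NormedSpace ℝ F]
    {n : ℕ} (hn : 0 < n) {f : UnitAddCircle → F} (hf : Integrable f) :
    ∫ x, avg n f x = ∫ x, f x := by
  have hn' : (n : ℝ) ≠ 0 := by positivity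
  unfold avg
  rw [integral_smul, integral_finsetSum _ fun k _ => hf.comp_add_right _]
  simp only [integral_add_right_eq_self, Finset.sum_const, Finset.card_range,
    ← Nat.cast_smul_eq_nsmul ℝ]
  rw [smul_smul, inv_mul_cancel₀ hn', one_smul]

/-- `avg n` is the conditional expectation onto the functions with period `1 / n`. -/
theorem integral_periodic_mul_avg {n : ℕ} (hn : 0 < n) {f g : UnitAddCircle → ℝ}
    (hfg : Integrable fun x => g x * f x)
    (hg : Function.Periodic g ((1 / (n : ℝ) : ℝ) : UnitAddCircle)) :
    ∫ x, g x * avg n f x = ∫ x, g x * f x := by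
  rw [← integral_avg hn hfg]
  congr 1
  funext x
  simp only [avg, smul_eq_mul, Finset.mul_sum]
  refine Finset.sum_congr rfl fun k _ => ?_
  rw [coe_div_eq_nsmul, hg.nsmul k x]
  ring

/-! ### Bounded nonnegative functions and finite maximal functions -/

/-- Bounded nonnegative measurable functions on the torus; all integrals in the proof of the
maximal inequality are integrals of such functions. -/
structure BddNonneg (f : UnitAddCircle → ℝ) : Prop where
  measurable : Measurable f
  nonneg : ∀ x, 0 ≤ f x
  bdd : ∃ C, ∀ x, f x ≤ C

namespace BddNonneg

variable {f g : UnitAddCircle → ℝ}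

theorem integrable (hf : BddNonneg f) : Integrable f := by
  obtain ⟨C, hC⟩ := hf.bdd
  exact Integrable.of_bound hf.measurable.aestronglyMeasurable C
    (ae_of_all _ fun x => by rw [Real.norm_of_nonneg (hf.nonneg x)]; exact hC x)

theorem avg (hf : BddNonneg f) {n : ℕ} (hn : 0 < n) : BddNonneg (avg n f) := by
  refine ⟨measurable_avg hf.measurable, avg_nonneg hf.nonneg, ?_⟩
  obtain ⟨C, hC⟩ := hf.bdd
  refine ⟨C, fun x => ?_⟩
  have := avg_mono (n := n) hC x
  rwa [avg_const hn] at this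

theorem add (hf : BddNonneg f) (hg : BddNonneg g) : BddNonneg fun x => f x + g x := by
  obtain ⟨C, hC⟩ := hf.bdd
  obtain ⟨D, hD⟩ := hg.bdd
  exact ⟨hf.measurable.add hg.measurable, fun x => add_nonneg (hf.nonneg x) (hg.nonneg x),
    C + D, fun x => add_le_add (hC x) (hD x)⟩

theorem mul (hf : BddNonneg f) (hg : BddNonneg g) : BddNonneg fun x => f x * g x := by
  obtain ⟨C, hC⟩ := hf.bdd
  obtain ⟨D, hD⟩ := hg.bdd
  exact ⟨hf.measurable.mul hg.measurable, fun x => mul_nonneg (hf.nonneg x) (hg.nonneg x),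
    C * D, fun x => mul_le_mul (hC x) (hD x) (hg.nonneg x) ((hf.nonneg x).trans (hC x))⟩

theorem max (hf : BddNonneg f) (hg : BddNonneg g) : BddNonneg fun x => max (f x) (g x) := by
  obtain ⟨C, hC⟩ := hf.bdd
  obtain ⟨D, hD⟩ := hg.bdd
  exact ⟨hf.measurable.max hg.measurable, fun x => le_max_of_le_left (hf.nonneg x),
    Max.max C D, fun x => max_le_max (hC x) (hD x)⟩

theorem zero : BddNonneg fun _ => 0 := ⟨measurable_const, fun _ => le_rfl, 0, fun _ => le_rfl⟩

theorem const_mul (hf : BddNonneg f) {c : ℝ} (hc : 0 ≤ c) : BddNonneg fun x => c * f x :=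
  mul ⟨measurable_const, fun _ => hc, c, fun _ => le_rfl⟩ hf

theorem rpow (hf : BddNonneg f) {p : ℝ} (hp : 0 ≤ p) : BddNonneg fun x => f x ^ p := by
  obtain ⟨C, hC⟩ := hf.bdd
  exact ⟨hf.measurable.pow_const p, fun x => Real.rpow_nonneg (hf.nonneg x) p,
    C ^ p, fun x => Real.rpow_le_rpow (hf.nonneg x) (hC x) hp⟩

theorem of_le (hg : BddNonneg g) (hf : Measurable f) (h0 : ∀ x, 0 ≤ f x) (h : ∀ x, f x ≤ g x) :
    BddNonneg f := by
  obtain ⟨C, hC⟩ := hg.bdd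
  exact ⟨hf, h0, C, fun x => (h x).trans (hC x)⟩

theorem sum {ι : Type*} {s : Finset ι} {F : ι → UnitAddCircle → ℝ}
    (h : ∀ i ∈ s, BddNonneg (F i)) : BddNonneg fun x => ∑ i ∈ s, F i x := by
  classical
  induction s using Finset.induction_on with
  | empty => simpa using zero
  | insert a s ha ih =>
    simp only [Finset.sum_insert ha]
    exact (h a (Finset.mem_insert_self a s)).add
      (ih fun i hi => h i (Finset.mem_insert_of_mem hi))

end BddNonneg

/-- Averaging contracts the `p`-th power integral. -/
theorem integral_avg_rpow_le {n : ℕ} (hn : 0 < n) {p : ℝ} (hp : 1 ≤ p) {f : UnitAddCircle → ℝ}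
    (hf : BddNonneg f) : ∫ x, avg n f x ^ p ≤ ∫ x, f x ^ p := by
  have hp0 : 0 ≤ p := zero_le_one.trans hp
  rw [← integral_avg hn (hf.rpow hp0).integrable]
  exact integral_mono ((hf.avg hn).rpow hp0).integrable ((hf.rpow hp0).avg hn).integrable
    (avg_rpow_le hn hp hf.nonneg)

/-- The maximal function `max (0, max_{n ∈ s} R_n f)`. -/
noncomputable def maxAvg (s : Finset ℕ) (f : UnitAddCircle → ℝ) (x : UnitAddCircle) : ℝ :=
  s.fold max 0 fun n => avg n f x

theorem maxAvg_empty (f : UnitAddCircle → ℝ) : maxAvg ∅ f = fun _ => 0 := by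
  funext x
  simp [maxAvg]

theorem maxAvg_insert (n : ℕ) (s : Finset ℕ) (f : UnitAddCircle → ℝ) :
    maxAvg (insert n s) f = fun x => max (avg n f x) (maxAvg s f x) := by
  funext x
  simp [maxAvg]

theorem maxAvg_nonneg (s : Finset ℕ) (f : UnitAddCircle → ℝ) (x : UnitAddCircle) :
    0 ≤ maxAvg s f x :=
  Finset.le_fold_max _ |>.2 (Or.inl le_rfl)

theorem avg_le_maxAvg {n : ℕ} {s : Finset ℕ} (hn : n ∈ s) (f : UnitAddCircle → ℝ)
    (x : UnitAddCircle) : avg n f x ≤ maxAvg s f x :=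
  Finset.le_fold_max _ |>.2 (Or.inr ⟨n, hn, le_rfl⟩)

theorem maxAvg_eq_zero_or (s : Finset ℕ) (f : UnitAddCircle → ℝ) (x : UnitAddCircle) :
    maxAvg s f x = 0 ∨ ∃ n ∈ s, maxAvg s f x = avg n f x := by
  rcases (Finset.le_fold_max _).1 (le_refl (maxAvg s f x)) with h | ⟨n, hn, h⟩
  · exact Or.inl (le_antisymm h (maxAvg_nonneg s f x))
  · exact Or.inr ⟨n, hn, le_antisymm h (avg_le_maxAvg hn f x)⟩

theorem BddNonneg.maxAvg {f : UnitAddCircle → ℝ} (hf : BddNonneg f) {s : Finset ℕ}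
    (hs : ∀ n ∈ s, 0 < n) : BddNonneg (maxAvg s f) := by
  induction s using Finset.induction_on with
  | empty => rw [maxAvg_empty]; exact BddNonneg.zero
  | insert a s ha ih =>
    rw [maxAvg_insert]
    exact (hf.avg (hs a (Finset.mem_insert_self a s))).max
      (ih fun n hn => hs n (Finset.mem_insert_of_mem hn))

theorem maxAvg_periodic {f : UnitAddCircle → ℝ} {s : Finset ℕ} (hs : ∀ n ∈ s, 0 < n) {m : ℕ}
    (hm : ∀ n ∈ s, m ∣ n) :
    Function.Periodic (maxAvg s f) ((1 / (m : ℝ) : ℝ) : UnitAddCircle) := by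
  intro x
  have h : ∀ n ∈ s, avg n f (x + ((1 / (m : ℝ) : ℝ) : UnitAddCircle)) = avg n f x := fun n hn =>
    periodic_of_dvd (hs n hn) (hm n hn) (avg_periodic (hs n hn) f) x
  exact Finset.fold_congr h

/-! ### Doob's inequality along a divisibility chain -/

theorem mul_rpow_sub_one {p t : ℝ} (hp : 1 < p) (ht : 0 ≤ t) : t * t ^ (p - 1) = t ^ p := by
  rcases ht.eq_or_lt with rfl | ht0
  · simp [Real.zero_rpow (by linarith : p ≠ 0)]
  · rw [Real.rpow_sub_one ht0.ne']
    field_simp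

theorem rpow_sub_rpow_le {p a b : ℝ} (hp : 1 < p) (ha : 0 ≤ a) (hb : 0 ≤ b) :
    a ^ p - b ^ p ≤ p / (p - 1) * (a * (a ^ (p - 1) - b ^ (p - 1))) := by
  have hpq := Real.HolderConjugate.conjExponent hp
  have hy := Real.young_inequality_of_nonneg ha (Real.rpow_nonneg hb (p - 1)) hpq
  have hp1 : 0 < p - 1 := by linarith
  have hq : Real.conjExponent p = p / (p - 1) := rfl
  rw [← Real.rpow_mul hb, hq, mul_div_cancel₀ _ hp1.ne'] at hy
  rw [mul_sub, mul_rpow_sub_one hp ha, div_mul_eq_mul_div, le_div_iff₀ hp1]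
  have h2 : p * (a * b ^ (p - 1)) ≤ p * (a ^ p / p + b ^ p / (p / (p - 1))) := by gcongr
  have h3 : p * (a ^ p / p + b ^ p / (p / (p - 1))) = a ^ p + (p - 1) * b ^ p := by
    field_simp
  linarith

theorem mul_rpow_sub_one_le {p a m : ℝ} (hp : 1 < p) (ha : 0 ≤ a) (hm : 0 ≤ m) :
    a * m ^ (p - 1) ≤ 1 / 2 * m ^ p + 2 ^ (p - 1) * a ^ p := by
  have hmp := Real.rpow_nonneg hm p
  have hap := Real.rpow_nonneg ha p
  have h2p : (0 : ℝ) ≤ 2 ^ (p - 1) := by positivity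
  rcases le_total (2 * a) m with h | h
  · have : a * m ^ (p - 1) ≤ 1 / 2 * m * m ^ (p - 1) := by
      gcongr
      linarith
    rw [mul_assoc, mul_rpow_sub_one hp hm] at this
    nlinarith [mul_nonneg h2p hap]
  · have : a * m ^ (p - 1) ≤ a * (2 * a) ^ (p - 1) := by
      gcongr
    rw [Real.mul_rpow zero_le_two ha] at this
    have h3 := mul_rpow_sub_one hp ha
    nlinarith

/-- The first half of Doob's maximal inequality: the averages along a divisibility chain form a
reverse martingale, and the maximum only grows, when a finer average is added, at points where it
equals that average. -/
theorem integral_maxAvg_rpow_le_mul {p : ℝ} (hp : 1 < p) {f : UnitAddCircle → ℝ}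
    (hf : BddNonneg f) (s : Finset ℕ) (hs : ∀ n ∈ s, 0 < n)
    (hc : ∀ m ∈ s, ∀ n ∈ s, m ∣ n ∨ n ∣ m) :
    ∫ x, maxAvg s f x ^ p ≤ p / (p - 1) * ∫ x, f x * maxAvg s f x ^ (p - 1) := by
  have hp1 : 0 < p - 1 := by linarith
  have hp0 : 0 < p := by linarith
  induction s using Finset.induction_on_min with
  | empty => simp [maxAvg_empty, Real.zero_rpow hp0.ne', Real.zero_rpow hp1.ne']
  | insert a s has ih =>
    have hs' : ∀ n ∈ s, 0 < n := fun n hn => hs n (Finset.mem_insert_of_mem hn)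
    have ha : 0 < a := hs a (Finset.mem_insert_self a s)
    have hdvd : ∀ n ∈ s, a ∣ n := fun n hn => by
      rcases hc a (Finset.mem_insert_self a s) n (Finset.mem_insert_of_mem hn) with h | h
      · exact h
      · exact absurd (Nat.le_of_dvd ha h) (not_le.2 (has n hn))
    have ih' := ih hs' fun m hm n hn =>
      hc m (Finset.mem_insert_of_mem hm) n (Finset.mem_insert_of_mem hn)
    have hm : BddNonneg (maxAvg s f) := hf.maxAvg hs'
    have hM : BddNonneg (maxAvg (insert a s) f) := hf.maxAvg hs
    have hX : BddNonneg (avg a f) := hf.avg ha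
    have hpt : ∀ x, maxAvg (insert a s) f x ^ p - maxAvg s f x ^ p ≤ p / (p - 1) *
        (maxAvg (insert a s) f x ^ (p - 1) * avg a f x - maxAvg s f x ^ (p - 1) * avg a f x) := by
      intro x
      simp only [maxAvg_insert]
      rcases le_total (avg a f x) (maxAvg s f x) with h | h
      · rw [max_eq_right h]
        simp
      · rw [max_eq_left h]
        refine (rpow_sub_rpow_le hp (hX.nonneg x) (hm.nonneg x)).trans_eq ?_
        ring
    have hint := integral_mono
      ((hM.rpow hp0.le).integrable.sub (hm.rpow hp0.le).integrable)
      ((((hM.rpow hp1.le).mul hX).integrable.sub ((hm.rpow hp1.le).mul hX).integrable).const_mul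
        (p / (p - 1))) hpt
    rw [integral_const_mul] at hint
    simp only [Pi.sub_apply] at hint
    rw [integral_sub (hM.rpow hp0.le).integrable (hm.rpow hp0.le).integrable,
      integral_sub ((hM.rpow hp1.le).mul hX).integrable ((hm.rpow hp1.le).mul hX).integrable,
      integral_periodic_mul_avg ha ((hM.rpow hp1.le).mul hf).integrable
        (fun x => by
          rw [maxAvg_periodic hs (m := a) (fun n hn => by
            rcases Finset.mem_insert.1 hn with rfl | hn
            · exact dvd_rfl
            · exact hdvd n hn) x]),
      integral_periodic_mul_avg ha ((hm.rpow hp1.le).mul hf).integrable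
        (fun x => by rw [maxAvg_periodic hs' hdvd x])] at hint
    simp only [mul_comm (f _)] at ih' ⊢
    linarith

/-- Doob's `L^p` inequality for the averages along a finite divisibility chain. -/
theorem exists_doob_const {p : ℝ} (hp : 1 < p) : ∃ A : ℝ, 0 ≤ A ∧
    ∀ s : Finset ℕ, (∀ n ∈ s, 0 < n) → (∀ m ∈ s, ∀ n ∈ s, m ∣ n ∨ n ∣ m) →
      ∀ f, BddNonneg f → ∫ x, maxAvg s f x ^ p ≤ A * ∫ x, f x ^ p := by
  have hp1 : 0 < p - 1 := by linarith
  have hp0 : 0 < p := by linarith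
  set q := p / (p - 1) with hq
  have hq0 : 0 ≤ q := by positivity
  refine ⟨2 * (2 ^ (p - 1) * q ^ p), by positivity, fun s hs hc f hf => ?_⟩
  have hM : BddNonneg (maxAvg s f) := hf.maxAvg hs
  have h1 := integral_maxAvg_rpow_le_mul hp hf s hs hc
  have h2 : ∫ x, q * (f x * maxAvg s f x ^ (p - 1)) ≤
      ∫ x, (1 / 2 * maxAvg s f x ^ p + 2 ^ (p - 1) * q ^ p * f x ^ p) := by
    refine integral_mono ((hf.mul (hM.rpow hp1.le)).const_mul hq0).integrable
      (((hM.rpow hp0.le).const_mul (by norm_num)).add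
        ((hf.rpow hp0.le).const_mul (by positivity))).integrable fun x => ?_
    have := mul_rpow_sub_one_le hp (mul_nonneg hq0 (hf.nonneg x)) (hM.nonneg x)
    rw [Real.mul_rpow hq0 (hf.nonneg x)] at this
    simpa only [mul_assoc] using this
  rw [integral_add ((hM.rpow hp0.le).const_mul (by norm_num)).integrable
    ((hf.rpow hp0.le).const_mul (by positivity)).integrable, integral_const_mul,
    integral_const_mul, integral_const_mul] at h2
  linarith

/-! ### The Bregman divergence of `x ^ p` -/

theorem bregman_pos {p x y : ℝ} (hp : 1 < p) (hx : 0 ≤ x) (hy : 0 ≤ y) (hxy : x ≠ y) :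
    0 < x ^ p - y ^ p - p * (y ^ (p - 1) * (x - y)) := by
  rcases hy.eq_or_lt with rfl | hy0
  · rw [Real.zero_rpow (by linarith), Real.zero_rpow (by linarith)]
    have := Real.rpow_pos_of_pos (hx.lt_of_ne' hxy) p
    linarith
  · have hb := one_add_mul_self_lt_rpow_one_add (s := x / y - 1) (by
      have : 0 ≤ x / y := by positivity
      linarith) (fun h => hxy (by field_simp at h; linarith)) hp
    rw [add_sub_cancel, Real.div_rpow hx hy, lt_div_iff₀ (by positivity)] at hb
    have h2 := mul_rpow_sub_one hp hy
    have h3 : (1 + p * (x / y - 1)) * y ^ p = y ^ p + p * (y ^ (p - 1) * (x - y)) := by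
      rw [← h2]
      field_simp
    linarith

theorem bregman_nonneg {p x y : ℝ} (hp : 1 < p) (hx : 0 ≤ x) (hy : 0 ≤ y) :
    0 ≤ x ^ p - y ^ p - p * (y ^ (p - 1) * (x - y)) := by
  rcases eq_or_ne x y with rfl | h
  · simp
  · exact (bregman_pos hp hx hy h).le

/-- Quantitative strict convexity: a jump `|x - y|` comparable with a common bound `m` of `x` and
`y` is controlled by the Bregman divergence. By homogeneity it suffices to take `m = 1`, where the
divergence is bounded below by compactness. -/
theorem exists_bregman_const {p l : ℝ} (hp : 1 < p) (hl : 0 < l) : ∃ K : ℝ, 0 ≤ K ∧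
    ∀ x y m : ℝ, 0 ≤ x → 0 ≤ y → x ≤ m → y ≤ m → l * m < |x - y| →
      |x - y| ^ p ≤ K * (x ^ p - y ^ p - p * (y ^ (p - 1) * (x - y))) := by
  have hp0 : 0 < p := by linarith
  have hp1 : 0 < p - 1 := by linarith
  set B : ℝ × ℝ → ℝ := fun z => z.1 ^ p - z.2 ^ p - p * (z.2 ^ (p - 1) * (z.1 - z.2)) with hB
  set S : Set (ℝ × ℝ) := (Set.Icc 0 1 ×ˢ Set.Icc 0 1) ∩ {z | l ≤ |z.1 - z.2|} with hS
  have hcomp : IsCompact S :=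
    (isCompact_Icc.prod isCompact_Icc).inter_right (isClosed_le (by fun_prop) (by fun_prop))
  have hcont : Continuous B := by
    have h1 : Continuous fun z : ℝ × ℝ => z.1 ^ p :=
      continuous_fst.rpow_const fun _ => Or.inr hp0.le
    have h2 : Continuous fun z : ℝ × ℝ => z.2 ^ p :=
      continuous_snd.rpow_const fun _ => Or.inr hp0.le
    have h3 : Continuous fun z : ℝ × ℝ => z.2 ^ (p - 1) :=
      continuous_snd.rpow_const fun _ => Or.inr hp1.le
    fun_prop
  obtain ⟨c, hc, hcB⟩ : ∃ c : ℝ, 0 < c ∧ ∀ z ∈ S, c ≤ B z := by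
    rcases S.eq_empty_or_nonempty with h | h
    · exact ⟨1, one_pos, by simp [h]⟩
    · obtain ⟨z, hz, hmin⟩ := hcomp.exists_isMinOn h hcont.continuousOn
      refine ⟨B z, bregman_pos hp hz.1.1.1 hz.1.2.1 fun h => ?_, fun w hw => hmin hw⟩
      have := hz.2
      simp only [Set.mem_ofPred_eq, h, sub_self, abs_zero] at this
      linarith
  refine ⟨c⁻¹, by positivity, fun x y m hx hy hxm hym hlt => ?_⟩
  have hm : 0 < m := by
    rcases (hx.trans hxm).eq_or_lt with rfl | h
    · rw [le_antisymm hxm hx, le_antisymm hym hy] at hlt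
      simp at hlt
    · exact h
  have hz : (x / m, y / m) ∈ S := by
    refine ⟨⟨⟨by positivity, (div_le_one hm).2 hxm⟩, ⟨by positivity, (div_le_one hm).2 hym⟩⟩, ?_⟩
    simp only [Set.mem_ofPred_eq]
    rw [← sub_div, abs_div, abs_of_pos hm, le_div_iff₀ hm]
    exact hlt.le
  have h1 := hcB _ hz
  have hmp := Real.rpow_pos_of_pos hm p
  have h2 : m ^ p * B (x / m, y / m) = x ^ p - y ^ p - p * (y ^ (p - 1) * (x - y)) := by
    simp only [hB]
    rw [Real.div_rpow hx hm.le, Real.div_rpow hy hm.le, Real.div_rpow hy hm.le,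
      ← mul_rpow_sub_one hp hm.le]
    have := Real.rpow_pos_of_pos hm (p - 1)
    field_simp
  have h3 : |x - y| ^ p ≤ m ^ p :=
    Real.rpow_le_rpow (abs_nonneg _) (abs_le.2 ⟨by linarith, by linarith⟩) hp0.le
  rw [← h2, inv_mul_eq_div, le_div_iff₀ hc]
  exact mul_le_mul h3 h1 hc.le hmp.le

/-- The `p`-th power integrals of a reverse martingale decrease exactly by the integrals of the
Bregman divergences of its jumps. -/
theorem integral_bregman_avg {p : ℝ} (hp : 1 < p) {f : UnitAddCircle → ℝ} (hf : BddNonneg f)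
    {m n : ℕ} (hm : 0 < m) (hn : 0 < n) (hmn : m ∣ n) :
    Integrable (fun x => avg m f x ^ p - avg n f x ^ p -
      p * (avg n f x ^ (p - 1) * (avg m f x - avg n f x))) ∧
    ∫ x, (avg m f x ^ p - avg n f x ^ p -
      p * (avg n f x ^ (p - 1) * (avg m f x - avg n f x))) =
    (∫ x, avg m f x ^ p) - ∫ x, avg n f x ^ p := by
  have hp0 : 0 ≤ p := by linarith
  have hp1 : 0 ≤ p - 1 := by linarith
  have hX := hf.avg hm
  have hY := hf.avg hn
  have i1 := (hX.rpow hp0).integrable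
  have i2 := (hY.rpow hp0).integrable
  have i3 := ((hY.rpow hp1).mul hX).integrable
  have i4 := ((hY.rpow hp1).mul hY).integrable
  have h0 : ∫ x, avg n f x ^ (p - 1) * avg m f x = ∫ x, avg n f x ^ (p - 1) * avg n f x := by
    rw [← integral_periodic_mul_avg hn i3 fun x => by rw [avg_periodic hn f x],
      avg_avg_of_dvd hn hm hmn]
  simp only [mul_sub]
  refine ⟨(i1.sub i2).sub ((i3.const_mul p).sub (i4.const_mul p)), ?_⟩
  have h1 := integral_sub' (i1.sub i2) ((i3.const_mul p).sub (i4.const_mul p))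
  rw [integral_sub' i1 i2, integral_sub' (i3.const_mul p) (i4.const_mul p), integral_const_mul,
    integral_const_mul, h0, sub_self, sub_zero] at h1
  exact h1

/-! ### The maximal inequality -/

theorem add_three_rpow_le {p a b c : ℝ} (hp : 0 ≤ p) (ha : 0 ≤ a) (hb : 0 ≤ b) (hc : 0 ≤ c) :
    (a + b + c) ^ p ≤ 3 ^ p * (a ^ p + b ^ p + c ^ p) := by
  have ha' := Real.rpow_nonneg ha p
  have hb' := Real.rpow_nonneg hb p
  have hc' := Real.rpow_nonneg hc p
  have key : ∀ d : ℝ, 0 ≤ d → a + b + c ≤ 3 * d → d ^ p ≤ a ^ p + b ^ p + c ^ p →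
      (a + b + c) ^ p ≤ 3 ^ p * (a ^ p + b ^ p + c ^ p) := fun d hd h1 h2 => by
    calc (a + b + c) ^ p ≤ (3 * d) ^ p := Real.rpow_le_rpow (by positivity) h1 hp
      _ = 3 ^ p * d ^ p := Real.mul_rpow (by norm_num) hd
      _ ≤ _ := by gcongr
  rcases le_total a b with h1 | h1 <;> rcases le_total b c with h2 | h2 <;>
    rcases le_total a c with h3 | h3
  all_goals first
    | exact key a ha (by linarith) (by linarith)
    | exact key b hb (by linarith) (by linarith)
    | exact key c hc (by linarith) (by linarith)

/-- A trivial bound, needed only to start the bootstrap from a finite constant. -/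
theorem integral_maxAvg_rpow_le_card {p : ℝ} (hp : 1 ≤ p) (s : Finset ℕ) (hs : ∀ n ∈ s, 0 < n)
    {f : UnitAddCircle → ℝ} (hf : BddNonneg f) :
    ∫ x, maxAvg s f x ^ p ≤ s.card * ∫ x, f x ^ p := by
  have hp0 : 0 ≤ p := by linarith
  have hb : ∀ n ∈ s, BddNonneg fun x => avg n f x ^ p := fun n hn => (hf.avg (hs n hn)).rpow hp0
  have h1 : ∫ x, maxAvg s f x ^ p ≤ ∫ x, ∑ n ∈ s, avg n f x ^ p := by
    refine integral_mono ((hf.maxAvg hs).rpow hp0).integrable (BddNonneg.sum hb).integrable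
      fun x => ?_
    rcases maxAvg_eq_zero_or s f x with h | ⟨n, hn, h⟩
    · simp only [h, Real.zero_rpow (by linarith : p ≠ 0)]
      exact Finset.sum_nonneg fun n hn => (hb n hn).nonneg x
    · simp only [h]
      exact Finset.single_le_sum (f := fun n => avg n f x ^ p)
        (fun n hn => (hb n hn).nonneg x) hn
  rw [integral_finsetSum _ fun n hn => (hb n hn).integrable] at h1
  refine h1.trans ((Finset.sum_le_sum fun n hn =>
    integral_avg_rpow_le (hs n hn) hp hf).trans_eq ?_)
  simp

/-- The combinatorial hypothesis of the maximal inequality for the Riemann sums along `n`: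
`M` is a divisibility chain with `M t ∣ n t`, and `lcm (n t) (M (t + 1))` is an lcm of members of
two divisibility chains. Thus `R_{n t}` splits into a part governed by two chains and a part which
depends only on the `t`-th jump of the reverse martingale along `M`. -/
structure ChainControlled (n M v w : ℕ → ℕ) : Prop where
  n_pos : ∀ t, 0 < n t
  M_pos : ∀ t, 0 < M t
  v_pos : ∀ t, 0 < v t
  w_pos : ∀ t, 0 < w t
  M_dvd_succ : ∀ t, M t ∣ M (t + 1)
  M_dvd : ∀ t, M t ∣ n t
  lcm_eq : ∀ t, Nat.lcm (n t) (M (t + 1)) = Nat.lcm (v t) (w t)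
  v_chain : ∀ s t, v s ∣ v t ∨ v t ∣ v s
  w_chain : ∀ s t, w s ∣ w t ∨ w t ∣ w s

theorem ChainControlled.avg_le {n M v w : ℕ → ℕ} (h : ChainControlled n M v w)
    {f : UnitAddCircle → ℝ} {s₁ s₂ : Finset ℕ} {t : ℕ} (hv : v t ∈ s₁) (hw : w t ∈ s₂)
    (x : UnitAddCircle) :
    avg (n t) f x ≤ maxAvg s₁ (maxAvg s₂ f) x +
      avg (n t) (fun y => |avg (M t) f y - avg (M (t + 1)) f y|) x := by
  have h1 : avg (n t) f = avg (v t) (avg (w t) f) +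
      avg (n t) (avg (M t) f - avg (M (t + 1)) f) := by
    rw [avg_sub, avg_avg_of_dvd (h.n_pos t) (h.M_pos t) (h.M_dvd t),
      avg_avg (h.n_pos t) (h.M_pos _), h.lcm_eq, avg_avg (h.v_pos t) (h.w_pos t)]
    abel
  rw [h1, Pi.add_apply]
  refine add_le_add ?_ (avg_mono (fun y => le_abs_self _) x)
  exact (avg_mono (avg_le_maxAvg hw f) x).trans (avg_le_maxAvg hv _ x)

/-- One step of the bootstrap: a bound for the maximal function with constant `B` improves to a
bound with constant `A + B / 2`, where `A` does not depend on the number `T` of averages. A jump of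
the martingale along `M` that is small compared with the maximal function of the martingale is
estimated by the assumed bound; the large jumps are summed by means of the Bregman divergence. -/
theorem ChainControlled.bootstrap {n M v w : ℕ → ℕ} (h : ChainControlled n M v w) {p : ℝ}
    (hp : 1 < p) : ∃ A : ℝ, 0 ≤ A ∧ ∀ (T : ℕ) (B : ℝ), 0 ≤ B →
      (∀ f, BddNonneg f →
        ∫ x, maxAvg ((Finset.range T).image n) f x ^ p ≤ B * ∫ x, f x ^ p) →
      ∀ f, BddNonneg f →
        ∫ x, maxAvg ((Finset.range T).image n) f x ^ p ≤ (A + B / 2) * ∫ x, f x ^ p := by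
  have hp0 : 0 < p := by linarith
  obtain ⟨A, hA, hdoob⟩ := exists_doob_const hp
  -- `l` is so small that `3 ^ p * l ^ p * A ≤ 1 / 2`
  obtain ⟨l, hl, hlA⟩ : ∃ l : ℝ, 0 < l ∧ 3 ^ p * (l ^ p * A) ≤ 1 / 2 := by
    refine ⟨(2 * 3 ^ p * (A + 1))⁻¹ ^ p⁻¹, by positivity, ?_⟩
    rw [Real.rpow_inv_rpow (by positivity) hp0.ne']
    have : (0 : ℝ) < 3 ^ p := by positivity
    field_simp
    linarith
  obtain ⟨K, hK, hbreg⟩ := exists_bregman_const hp hl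
  refine ⟨3 ^ p * (A * A + K), by positivity, fun T B hB hTB f hf => ?_⟩
  set sn := (Finset.range T).image n
  set sv := (Finset.range T).image v
  set sw := (Finset.range T).image w
  set sM := (Finset.range (T + 1)).image M
  have hpos : ∀ (c : ℕ → ℕ) (k : ℕ), (∀ t, 0 < c t) → ∀ a ∈ (Finset.range k).image c, 0 < a := by
    intro c k hc a ha
    obtain ⟨t, -, rfl⟩ := Finset.mem_image.1 ha
    exact hc t
  have hchain : ∀ (c : ℕ → ℕ) (k : ℕ), (∀ s t, c s ∣ c t ∨ c t ∣ c s) →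
      ∀ a ∈ (Finset.range k).image c, ∀ b ∈ (Finset.range k).image c, a ∣ b ∨ b ∣ a := by
    intro c k hc a ha b hb
    obtain ⟨s, -, rfl⟩ := Finset.mem_image.1 ha
    obtain ⟨t, -, rfl⟩ := Finset.mem_image.1 hb
    exact hc s t
  have hMmono : ∀ s t, s ≤ t → M s ∣ M t := fun s t hst =>
    Nat.le_induction dvd_rfl (fun k _ ih => ih.trans (h.M_dvd_succ k)) t hst
  have hMchain : ∀ s t, M s ∣ M t ∨ M t ∣ M s := fun s t =>
    (le_total s t).imp (hMmono s t) (hMmono t s)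
  set m := maxAvg sM f
  have hmb : BddNonneg m := hf.maxAvg (hpos M _ h.M_pos)
  have hwb : BddNonneg (maxAvg sw f) := hf.maxAvg (hpos w _ h.w_pos)
  have hvb : BddNonneg (maxAvg sv (maxAvg sw f)) := hwb.maxAvg (hpos v _ h.v_pos)
  have hnb : BddNonneg (maxAvg sn f) := hf.maxAvg (hpos n _ h.n_pos)
  have hnmb : BddNonneg (maxAvg sn m) := hmb.maxAvg (hpos n _ h.n_pos)
  -- the jumps of the martingale, and their large parts
  set D : ℕ → UnitAddCircle → ℝ := fun t y => |avg (M t) f y - avg (M (t + 1)) f y| with hD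
  set H : ℕ → UnitAddCircle → ℝ := fun t y => if l * m y < D t y then D t y else 0 with hH
  have hDm : ∀ t, Measurable (D t) := fun t =>
    ((hf.avg (h.M_pos t)).measurable.sub (hf.avg (h.M_pos (t + 1))).measurable).abs
  have hDH : ∀ t y, D t y ≤ l * m y + H t y := by
    intro t y
    simp only [hH]
    split_ifs with hc
    · have := mul_nonneg hl.le (hmb.nonneg y)
      linarith
    · linarith
  have hHb : ∀ t, BddNonneg (H t) := by
    intro t
    refine BddNonneg.of_le ((hf.avg (h.M_pos t)).add (hf.avg (h.M_pos (t + 1)))) ?_ ?_ ?_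
    · exact Measurable.ite (measurableSet_lt (hmb.measurable.const_mul l) (hDm t)) (hDm t)
        measurable_const
    · intro y
      simp only [hH]
      split_ifs
      · exact abs_nonneg _
      · exact le_rfl
    · intro y
      have h1 := (hf.avg (h.M_pos t)).nonneg y
      have h2 := (hf.avg (h.M_pos (t + 1))).nonneg y
      simp only [hH]
      split_ifs
      · exact abs_le.2 ⟨by linarith, by linarith⟩
      · linarith
  have hHint : ∀ t ∈ Finset.range T, ∫ x, H t x ^ p ≤
      K * ((∫ x, avg (M t) f x ^ p) - ∫ x, avg (M (t + 1)) f x ^ p) := by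
    intro t ht
    obtain ⟨hi, he⟩ := integral_bregman_avg hp hf (h.M_pos t) (h.M_pos (t + 1)) (h.M_dvd_succ t)
    rw [← he, ← integral_const_mul]
    refine integral_mono ((hHb t).rpow hp0.le).integrable (hi.const_mul K) fun x => ?_
    have hx := (hf.avg (h.M_pos t)).nonneg x
    have hy := (hf.avg (h.M_pos (t + 1))).nonneg x
    have ht' := Finset.mem_range.1 ht
    simp only [hH]
    split_ifs with hc
    · exact hbreg _ _ (m x) hx hy
        (avg_le_maxAvg (Finset.mem_image_of_mem M (Finset.mem_range.2 (by omega))) f x)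
        (avg_le_maxAvg (Finset.mem_image_of_mem M (Finset.mem_range.2 (by omega))) f x) hc
    · rw [Real.zero_rpow hp0.ne']
      exact mul_nonneg hK (bregman_nonneg hp hx hy)
  have hHsum : ∑ t ∈ Finset.range T, ∫ x, avg (n t) (H t) x ^ p ≤ K * ∫ x, f x ^ p := by
    calc ∑ t ∈ Finset.range T, ∫ x, avg (n t) (H t) x ^ p
        ≤ ∑ t ∈ Finset.range T, K * ((∫ x, avg (M t) f x ^ p) - ∫ x, avg (M (t + 1)) f x ^ p) :=
          Finset.sum_le_sum fun t ht =>
            (integral_avg_rpow_le (h.n_pos t) hp.le (hHb t)).trans (hHint t ht)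
      _ = K * ((∫ x, avg (M 0) f x ^ p) - ∫ x, avg (M T) f x ^ p) := by
          rw [← Finset.mul_sum, Finset.sum_range_sub' fun t => ∫ x, avg (M t) f x ^ p]
      _ ≤ K * ∫ x, f x ^ p := by
          have h1 := integral_avg_rpow_le (h.M_pos 0) hp.le hf
          have h2 : 0 ≤ ∫ x, avg (M T) f x ^ p :=
            integral_nonneg ((hf.avg (h.M_pos T)).rpow hp0.le).nonneg
          gcongr
          linarith
  have hHnb : ∀ t ∈ Finset.range T, BddNonneg fun x => avg (n t) (H t) x ^ p := fun t _ =>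
    ((hHb t).avg (h.n_pos t)).rpow hp0.le
  have hpt : ∀ x, maxAvg sn f x ^ p ≤ 3 ^ p * (maxAvg sv (maxAvg sw f) x ^ p +
      l ^ p * maxAvg sn m x ^ p + ∑ t ∈ Finset.range T, avg (n t) (H t) x ^ p) := by
    intro x
    have hs0 := (BddNonneg.sum hHnb).nonneg x
    have hv0 := hvb.nonneg x
    have hn0 := hnmb.nonneg x
    rcases maxAvg_eq_zero_or sn f x with h0 | ⟨a, ha, h0⟩
    · rw [h0, Real.zero_rpow hp0.ne']
      positivity
    · obtain ⟨t, ht, rfl⟩ := Finset.mem_image.1 ha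
      have hHt := ((hHb t).avg (h.n_pos t)).nonneg x
      have h1 : avg (n t) f x ≤ maxAvg sv (maxAvg sw f) x + l * maxAvg sn m x +
          avg (n t) (H t) x := by
        have h2 := h.avg_le (f := f) (Finset.mem_image_of_mem v ht) (Finset.mem_image_of_mem w ht) x
        have h3 : avg (n t) (D t) x ≤ avg (n t) (l • m + H t) x := avg_mono (hDH t) x
        rw [avg_add, avg_smul] at h3
        simp only [Pi.add_apply, Pi.smul_apply, smul_eq_mul] at h3
        have h4 := mul_le_mul_of_nonneg_left (avg_le_maxAvg ha m x) hl.le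
        linarith
      rw [h0]
      refine (Real.rpow_le_rpow (avg_nonneg hf.nonneg x) h1 hp0.le).trans
        ((add_three_rpow_le hp0.le hv0 (by positivity) hHt).trans ?_)
      rw [Real.mul_rpow hl.le hn0]
      have h5 := Finset.single_le_sum (f := fun t => avg (n t) (H t) x ^ p)
        (fun t ht => (hHnb t ht).nonneg x) ht
      gcongr
  have hl0 : 0 ≤ l ^ p := by positivity
  have j1 := hvb.rpow hp0.le
  have j2 := (hnmb.rpow hp0.le).const_mul hl0
  have j3 := BddNonneg.sum hHnb
  have hint := integral_mono (hnb.rpow hp0.le).integrable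
    (((j1.add j2).add j3).const_mul (by positivity : (0 : ℝ) ≤ 3 ^ p)).integrable hpt
  rw [integral_const_mul, integral_add (j1.add j2).integrable j3.integrable,
    integral_add j1.integrable j2.integrable, integral_const_mul,
    integral_finsetSum _ fun t ht => (hHnb t ht).integrable] at hint
  refine hint.trans ?_
  have b1 := hdoob sv (hpos v _ h.v_pos) (hchain v _ h.v_chain) _ hwb
  have b2 := hdoob sw (hpos w _ h.w_pos) (hchain w _ h.w_chain) _ hf
  have b3 := hTB m hmb
  have b4 := hdoob sM (hpos M _ h.M_pos) (hchain M _ hMchain) _ hf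
  have hf0 : 0 ≤ ∫ x, f x ^ p := integral_nonneg (hf.rpow hp0.le).nonneg
  calc 3 ^ p * ((∫ x, maxAvg sv (maxAvg sw f) x ^ p) + l ^ p * (∫ x, maxAvg sn m x ^ p) +
        ∑ t ∈ Finset.range T, ∫ x, avg (n t) (H t) x ^ p)
      ≤ 3 ^ p * (A * (A * ∫ x, f x ^ p) + l ^ p * (B * (A * ∫ x, f x ^ p)) +
          K * ∫ x, f x ^ p) := by
        gcongr
        · exact b1.trans (by gcongr)
        · exact b3.trans (by gcongr)
    _ = 3 ^ p * (A * A + K) * (∫ x, f x ^ p) +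
          3 ^ p * (l ^ p * A) * (B * ∫ x, f x ^ p) := by ring
    _ ≤ 3 ^ p * (A * A + K) * (∫ x, f x ^ p) + 1 / 2 * (B * ∫ x, f x ^ p) := by gcongr
    _ = (3 ^ p * (A * A + K) + B / 2) * ∫ x, f x ^ p := by ring

/-- The maximal inequality, with a constant independent of the number of averages: iterating the
bootstrap replaces the initial constant `B` by `2 * A + B / 2 ^ k`. -/
theorem ChainControlled.exists_maximal_const {n M v w : ℕ → ℕ} (h : ChainControlled n M v w)
    {p : ℝ} (hp : 1 < p) : ∃ A : ℝ, 0 ≤ A ∧ ∀ (T : ℕ) (f : UnitAddCircle → ℝ), BddNonneg f →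
      ∫ x, maxAvg ((Finset.range T).image n) f x ^ p ≤ A * ∫ x, f x ^ p := by
  obtain ⟨A, hA, hboot⟩ := h.bootstrap hp
  refine ⟨2 * A, by positivity, fun T f hf => ?_⟩
  set s := (Finset.range T).image n
  have hs : ∀ a ∈ s, 0 < a := by
    intro a ha
    obtain ⟨t, -, rfl⟩ := Finset.mem_image.1 ha
    exact h.n_pos t
  have hk : ∀ (k : ℕ) (f), BddNonneg f →
      ∫ x, maxAvg s f x ^ p ≤ (2 * A + s.card * (1 / 2) ^ k) * ∫ x, f x ^ p := by
    intro k
    induction k with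
    | zero =>
      intro f hf
      refine (integral_maxAvg_rpow_le_card hp.le s hs hf).trans ?_
      have hf0 : 0 ≤ ∫ x, f x ^ p := integral_nonneg (hf.rpow (by linarith)).nonneg
      gcongr
      simp only [pow_zero, mul_one]
      linarith
    | succ k ih =>
      intro f hf
      refine (hboot T _ (by positivity) ih f hf).trans_eq ?_
      rw [pow_succ]
      ring
  have hlim : Tendsto (fun k : ℕ => (2 * A + s.card * (1 / 2) ^ k) * ∫ x, f x ^ p) atTop
      (𝓝 ((2 * A + s.card * 0) * ∫ x, f x ^ p)) :=
    ((tendsto_pow_atTop_nhds_zero_of_lt_one (by norm_num) (by norm_num)).const_mul _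
      |>.const_add _).mul_const _
  rw [mul_zero, add_zero] at hlim
  exact ge_of_tendsto' hlim fun k => hk k f hf

/-! ### The set of infinite dimension -/

/-- A sequence of distinct primes indexed by pairs. -/
noncomputable def pairPrime (e : ℕ × ℕ) : ℕ := Nat.nth Nat.Prime (Nat.pair e.1 e.2)

theorem pairPrime_prime (e : ℕ × ℕ) : (pairPrime e).Prime :=
  Nat.prime_nth_prime _

theorem pairPrime_injective : Function.Injective pairPrime := by
  intro e e' h
  have := Nat.nth_injective Nat.infinite_setOfPred_prime h
  exact Nat.pairEquiv.injective this

theorem lt_pairPrime (a b : ℕ) : b < pairPrime (a, b) :=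
  calc b ≤ Nat.pair a b := Nat.right_le_pair a b
    _ < Nat.pair a b + 2 := by omega
    _ ≤ _ := Nat.add_two_le_nth_prime _

theorem lcm_pairPrime_pos (S : Finset (ℕ × ℕ)) : 0 < S.lcm pairPrime := by
  refine Nat.pos_of_ne_zero fun h => ?_
  obtain ⟨e, -, he⟩ := Finset.lcm_eq_zero_iff.1 h
  exact (pairPrime_prime e).ne_zero he

theorem pairPrime_dvd_lcm_iff {S : Finset (ℕ × ℕ)} {e : ℕ × ℕ} :
    pairPrime e ∣ S.lcm pairPrime ↔ e ∈ S := by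
  refine ⟨fun h => ?_, fun h => Finset.dvd_lcm h⟩
  have h1 : S.lcm pairPrime ∣ ∏ e ∈ S, pairPrime e :=
    Finset.lcm_dvd fun e he => Finset.dvd_prod_of_mem _ he
  obtain ⟨e', he', h2⟩ := ((pairPrime_prime e).prime.dvd_finsetProd_iff _).1 (h.trans h1)
  rwa [pairPrime_injective ((Nat.prime_dvd_prime_iff_eq (pairPrime_prime e)
    (pairPrime_prime e')).1 h2)]

/-- The pairs `(a, b)` with `a < b < 2 ^ (log₂ t + 1)` that satisfy `P`. The vertices
`0, 1, 2, …` are grouped into the dyadic blocks `[2 ^ k, 2 ^ (k + 1))`, and the bound is the end of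
the block of `t`. -/
def edges (t : ℕ) (P : ℕ → ℕ → Prop) [DecidableRel P] : Finset (ℕ × ℕ) :=
  (Finset.range (2 ^ (Nat.log 2 t + 1)) ×ˢ Finset.range (2 ^ (Nat.log 2 t + 1))).filter
    fun e => e.1 < e.2 ∧ P e.1 e.2

theorem mem_edges {t : ℕ} {P : ℕ → ℕ → Prop} [DecidableRel P] {a b : ℕ} :
    (a, b) ∈ edges t P ↔ a < b ∧ b < 2 ^ (Nat.log 2 t + 1) ∧ P a b := by
  simp only [edges, Finset.mem_filter, Finset.mem_product, Finset.mem_range]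
  constructor
  · rintro ⟨⟨-, h2⟩, h3, h4⟩
    exact ⟨h3, h2, h4⟩
  · rintro ⟨h1, h2, h3⟩
    exact ⟨⟨h1.trans h2, h2⟩, h1, h3⟩

/-- The product of the primes attached to the pairs that end before the end of the block of `t` and
do not contain `t`. It is written as an lcm, so that unions of sets of pairs correspond to lcms. -/
noncomputable def starNum (t : ℕ) : ℕ := (edges t fun a b => a ≠ t ∧ b ≠ t).lcm pairPrime

theorem starNum_pos (t : ℕ) : 0 < starNum t := lcm_pairPrime_pos _

theorem pairPrime_dvd_starNum_iff {t a b : ℕ} (hab : a < b) :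
    pairPrime (a, b) ∣ starNum t ↔ b < 2 ^ (Nat.log 2 t + 1) ∧ a ≠ t ∧ b ≠ t := by
  simp [starNum, pairPrime_dvd_lcm_iff, mem_edges, hab]

theorem infinite_range_starNum : (Set.range starNum).Infinite := by
  refine Set.infinite_of_not_bddAbove fun ⟨B, hB⟩ => ?_
  have h1 : pairPrime (0, B + 1) ∣ starNum (B + 2) := by
    rw [pairPrime_dvd_starNum_iff (by omega)]
    have := Nat.lt_pow_succ_log_self one_lt_two (B + 2)
    exact ⟨by omega, by omega, by omega⟩
  have h2 := Nat.le_of_dvd (starNum_pos _) h1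
  have h3 := lt_pairPrime 0 (B + 1)
  have h4 := hB (Set.mem_range_self (B + 2))
  omega

/-- With `M t` given by the pairs `b < t`, the pairs of `starNum t` or `M (t + 1)` are those with
`a ≠ t`; they are covered by the pairs with `a < t`, which increase with `t`, and by the pairs with
`t < a` or `b` in an earlier block, which decrease with `t` inside each block and increase from
block to block. -/
theorem chainControlled_starNum : ChainControlled starNum
    (fun t => (edges t fun _ b => b < t).lcm pairPrime)
    (fun t => (edges t fun a _ => a < t).lcm pairPrime)
    (fun t => (edges t fun a b => t < a ∨ b < 2 ^ Nat.log 2 t).lcm pairPrime) := by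
  have hlt : ∀ t : ℕ, t < 2 ^ (Nat.log 2 t + 1) := fun t => Nat.lt_pow_succ_log_self one_lt_two t
  have hle : ∀ t : ℕ, 2 ^ Nat.log 2 t ≤ t + 1 := fun t => Nat.pow_log_le_add_one 2 t
  have hmono : ∀ {s t : ℕ}, s ≤ t → 2 ^ (Nat.log 2 s + 1) ≤ 2 ^ (Nat.log 2 t + 1) := fun h =>
    Nat.pow_le_pow_right two_pos (Nat.succ_le_succ (Nat.log_mono_right h))
  refine ⟨starNum_pos, fun _ => lcm_pairPrime_pos _, fun _ => lcm_pairPrime_pos _,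
    fun _ => lcm_pairPrime_pos _, fun t => Finset.lcm_mono ?_, fun t => Finset.lcm_mono ?_,
    fun t => ?_, fun s t => ?_, fun s t => ?_⟩
  · rintro ⟨a, b⟩ h
    rw [mem_edges] at h ⊢
    have := hmono (Nat.le_add_right t 1)
    omega
  · rintro ⟨a, b⟩ h
    rw [mem_edges] at h ⊢
    omega
  · have key : ∀ S T : Finset (ℕ × ℕ), Nat.lcm (S.lcm pairPrime) (T.lcm pairPrime) =
        (S ∪ T).lcm pairPrime := fun S T => Finset.lcm_union.symm
    rw [starNum, key, key]
    congr 1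
    ext ⟨a, b⟩
    simp only [Finset.mem_union, mem_edges]
    have h1 := hmono (Nat.le_add_right t 1)
    have h2 := hle t
    have h3 := hlt t
    omega
  · wlog hst : s ≤ t generalizing s t
    · exact (this t s (le_of_not_ge hst)).symm
    refine Or.inl (Finset.lcm_mono ?_)
    rintro ⟨a, b⟩ h
    rw [mem_edges] at h ⊢
    have := hmono hst
    omega
  · wlog hst : s ≤ t generalizing s t
    · exact (this t s (le_of_not_ge hst)).symm
    rcases (Nat.log_mono_right (b := 2) hst).eq_or_lt with h | h
    · refine Or.inr (Finset.lcm_mono ?_)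
      rintro ⟨a, b⟩ hab
      rw [mem_edges] at hab ⊢
      rw [h]
      omega
    · refine Or.inl (Finset.lcm_mono ?_)
      rintro ⟨a, b⟩ hab
      rw [mem_edges] at hab ⊢
      have h1 : 2 ^ (Nat.log 2 s + 1) ≤ 2 ^ Nat.log 2 t := Nat.pow_le_pow_right two_pos h
      have h2 : 2 ^ Nat.log 2 t < 2 ^ (Nat.log 2 t + 1) :=
        Nat.pow_lt_pow_right one_lt_two (by omega)
      omega

theorem IsDivChain.dvd_or_dvd {S : Set ℕ} (hS : IsDivChain S) {a b : ℕ} (ha : a ∈ S) (hb : b ∈ S) :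
    a ∣ b ∨ b ∣ a := by
  obtain ⟨s, -, hs, rfl⟩ := hS
  obtain ⟨i, rfl⟩ := ha
  obtain ⟨j, rfl⟩ := hb
  have hmono : ∀ i j, i ≤ j → s i ∣ s j := fun i j hij =>
    Nat.le_induction dvd_rfl (fun k _ ih => ih.trans (hs k)) j hij
  exact (le_total i j).imp (hmono i j) (hmono j i)

/-- If the pairs of elements of a sufficiently large ordered set are coloured with finitely many
colours, two consecutive pairs `s < t` and `t < u` have the same colour: otherwise the sets of
colours of the pairs ending at the various elements are distinct. -/
theorem exists_monochromatic_path {κ : Type*} [Finite κ] (c : ℕ → ℕ → κ) {A : Finset ℕ}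
    (hA : Nat.card (Set κ) < A.card) :
    ∃ s ∈ A, ∃ t ∈ A, ∃ u ∈ A, s < t ∧ t < u ∧ c s t = c t u := by
  classical
  have := Fintype.ofFinite (Set κ)
  rw [Nat.card_eq_fintype_card, ← Finset.card_univ] at hA
  obtain ⟨t, ht, u, hu, htu, h⟩ := Finset.exists_ne_map_eq_of_card_lt_of_maps_to hA
    (f := fun t => {k : κ | ∃ s ∈ A, s < t ∧ c s t = k}) fun _ _ =>
      Finset.mem_coe.2 (Finset.mem_univ _)
  wlog hlt : t < u generalizing t u
  · exact this u hu t ht htu.symm h.symm (lt_of_le_of_ne (not_lt.1 hlt) htu.symm)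
  have h1 : c t u ∈ {k : κ | ∃ s ∈ A, s < u ∧ c s u = k} := ⟨t, ht, hlt, rfl⟩
  rw [← h] at h1
  obtain ⟨s, hs, hst, hc⟩ := h1
  exact ⟨s, hs, t, ht, u, hu, hst, hlt, hc⟩

/-- If `d` chains contained the set, then some `s < t < u` in one block would have the property that
each of the `d` components of `starNum t` divides the corresponding component of `starNum s` or of
`starNum u`; but the prime of the pair `(s, u)` divides only the first of these three numbers. -/
theorem dimension_range_starNum : dimension (Set.range starNum) = ⊤ := by
  refine sInf_eq_top.2 ?_
  rintro D ⟨d, -, -, S, hS, hsub⟩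
  exfalso
  choose m hmS hm using fun t => hsub (Set.mem_range_self t)
  set k := Nat.card (Set (Fin d → Prop)) with hk
  have hcard : Nat.card (Set (Fin d → Prop)) < (Finset.Ico (2 ^ k) (2 ^ (k + 1))).card := by
    rw [Nat.card_Ico, pow_succ, ← hk]
    have := Nat.lt_two_pow_self (n := k)
    omega
  obtain ⟨s, hs, t, ht, u, hu, hst, htu, hc⟩ :=
    exists_monochromatic_path (fun s t i => m s i ∣ m t i) hcard
  have hlog : ∀ r ∈ Finset.Ico (2 ^ k) (2 ^ (k + 1)), Nat.log 2 r = k := fun r hr =>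
    Nat.log_eq_of_pow_le_of_lt_pow (Finset.mem_Ico.1 hr).1 (Finset.mem_Ico.1 hr).2
  have hdvd : ∀ r i, m r i ∣ starNum r := fun r i => by
    rw [hm r]
    exact Finset.dvd_lcm (Finset.mem_univ i)
  have hq : (pairPrime (s, u)).Prime := pairPrime_prime _
  have hqt : pairPrime (s, u) ∣ starNum t := by
    rw [pairPrime_dvd_starNum_iff (hst.trans htu), hlog t ht]
    exact ⟨(Finset.mem_Ico.1 hu).2, hst.ne, htu.ne'⟩
  have hqs : ¬ pairPrime (s, u) ∣ starNum s := fun h =>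
    ((pairPrime_dvd_starNum_iff (hst.trans htu)).1 h).2.1 rfl
  have hqu : ¬ pairPrime (s, u) ∣ starNum u := fun h =>
    ((pairPrime_dvd_starNum_iff (hst.trans htu)).1 h).2.2 rfl
  obtain ⟨i, hi⟩ : ∃ i, pairPrime (s, u) ∣ m t i := by
    rw [hm t] at hqt
    obtain ⟨i, -, hi⟩ := (hq.prime.dvd_finsetProd_iff _).1
      (hqt.trans (Finset.lcm_dvd fun i hi => Finset.dvd_prod_of_mem (m t) hi))
    exact ⟨i, hi⟩
  have hci := congrFun hc i
  simp only [eq_iff_iff] at hci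
  by_cases h : m s i ∣ m t i
  · exact hqu (hi.trans ((hci.1 h).trans (hdvd u i)))
  · exact hqs (hi.trans ((((hS i).dvd_or_dvd (hmS s i) (hmS t i)).resolve_left h).trans (hdvd s i)))

/-! ### Riemann sums of continuous functions -/

theorem avg_fourier {n : ℕ} (hn : 0 < n) {k : ℤ} (hk : ¬ (n : ℤ) ∣ k) :
    avg n (fourier k : C(UnitAddCircle, ℂ)) = 0 := by
  set e : C(UnitAddCircle, ℂ) := fourier k with he
  have hadd : ∀ x y : UnitAddCircle, e (x + y) = e y * e x := fun x y => by
    simp [he, fourier_apply, smul_add, AddCircle.toCircle_add, mul_comm]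
  have hne : e ((1 / (n : ℝ) : ℝ) : UnitAddCircle) ≠ 1 := by
    rw [he, fourier_coe_apply]
    intro h
    obtain ⟨j, hj⟩ := Complex.exp_eq_one_iff.1 h
    have hn' : (n : ℂ) ≠ 0 := by exact_mod_cast hn.ne'
    have hpi := Complex.two_pi_I_ne_zero
    push_cast at hj
    have h2 : (k : ℂ) = n * j := by
      have h3 : 2 * (Real.pi : ℂ) * Complex.I * k =
          2 * (Real.pi : ℂ) * Complex.I * (n * j) := by
        field_simp at hj
        linear_combination (2 * (Real.pi : ℂ) * Complex.I) * hj
      exact mul_left_cancel₀ hpi h3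
    exact hk ⟨j, by exact_mod_cast h2⟩
  funext x
  have h1 := avg_periodic hn e x
  have h2 : avg n e (x + ((1 / (n : ℝ) : ℝ) : UnitAddCircle)) =
      e ((1 / (n : ℝ) : ℝ) : UnitAddCircle) * avg n e x := by
    simp only [avg, add_right_comm x, hadd _ ((1 / (n : ℝ) : ℝ) : UnitAddCircle),
      ← Finset.mul_sum, mul_smul_comm]
  rw [h2] at h1
  by_contra h3
  exact hne (mul_right_cancel₀ h3 (h1.trans (one_mul _).symm))

instance isProbabilityMeasure_volume : IsProbabilityMeasure (volume : Measure UnitAddCircle) :=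
  ⟨UnitAddCircle.measure_univ⟩

theorem integrable_continuousMap (f : C(UnitAddCircle, ℂ)) : Integrable f :=
  f.continuous.integrable_of_hasCompactSupport (HasCompactSupport.of_compactSpace _)

/-- The Riemann sums of a trigonometric polynomial are eventually equal to its integral. -/
theorem eventually_avg_eq_integral {f : C(UnitAddCircle, ℂ)}
    (hf : f ∈ Submodule.span ℂ (Set.range (fourier (T := 1)))) :
    ∀ᶠ n : ℕ in atTop, ∀ x, avg n f x = ∫ t, f t := by
  induction hf using Submodule.span_induction with
  | mem f hf =>
    obtain ⟨k, rfl⟩ := hf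
    filter_upwards [eventually_gt_atTop k.natAbs] with n hn x
    have hn0 : 0 < n := by omega
    rcases eq_or_ne k 0 with rfl | hk
    · rw [avg_of_periodic hn0 (by intro y; simp)]
      simp
    · have hdvd : ¬ (n : ℤ) ∣ k := fun h => by
        have := Nat.le_of_dvd (Int.natAbs_pos.2 hk) (Int.natCast_dvd.1 h)
        omega
      rw [← integral_avg hn0 (integrable_continuousMap _), avg_fourier hn0 hdvd]
      simp
  | zero => simp [avg]
  | add f g _ _ hf hg =>
    filter_upwards [hf, hg] with n h1 h2 x
    rw [ContinuousMap.coe_add, avg_add, Pi.add_apply, h1, h2]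
    simp only [Pi.add_apply]
    rw [integral_add (integrable_continuousMap f) (integrable_continuousMap g)]
  | smul c f _ hf =>
    filter_upwards [hf] with n h1 x
    simp only [ContinuousMap.coe_smul, Pi.smul_apply]
    rw [integral_smul, ← h1 x]
    simp [avg, Finset.mul_sum, mul_left_comm]

theorem norm_avg_le_of_norm_le {n : ℕ} (hn : 0 < n) {f : UnitAddCircle → ℂ} {C : ℝ}
    (hf : ∀ x, ‖f x‖ ≤ C) (x : UnitAddCircle) : ‖avg n f x‖ ≤ C := by
  refine (norm_avg_le n f x).trans ((avg_mono hf x).trans_eq ?_)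
  rw [avg_const hn]

theorem tendsto_avg_continuousMap (f : C(UnitAddCircle, ℂ)) (x : UnitAddCircle) :
    Tendsto (fun n : ℕ => avg n f x) atTop (𝓝 (∫ t, f t)) := by
  rw [Metric.tendsto_nhds]
  intro ε hε
  have hmem : f ∈ (Submodule.span ℂ (Set.range (fourier (T := 1)))).topologicalClosure := by
    rw [span_fourier_closure_eq_top]
    trivial
  obtain ⟨P, hP, hfP⟩ := Metric.mem_closure_iff.1 hmem (ε / 3) (by positivity)
  have hnorm : ∀ y, ‖(f - P) y‖ ≤ ε / 3 := fun y => by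
    rw [dist_eq_norm] at hfP
    exact ((f - P).norm_coe_le_norm y).trans hfP.le
  filter_upwards [eventually_avg_eq_integral hP, eventually_gt_atTop 0] with n hn hn0
  have h1 : ‖avg n (f - P : C(UnitAddCircle, ℂ)) x‖ ≤ ε / 3 := norm_avg_le_of_norm_le hn0 hnorm x
  have h2 : ‖∫ t, (f - P) t‖ ≤ ε / 3 := by
    have := norm_integral_le_of_norm_le_const (μ := (volume : Measure UnitAddCircle))
      (ae_of_all _ hnorm)
    rwa [probReal_univ, mul_one] at this
  rw [ContinuousMap.coe_sub, avg_sub, Pi.sub_apply, hn x] at h1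
  simp only [ContinuousMap.coe_sub, Pi.sub_apply] at h2
  rw [integral_sub (integrable_continuousMap f) (integrable_continuousMap P)] at h2
  have h3 : avg n f x - ∫ t, f t =
      (avg n f x - ∫ t, P t) - ((∫ t, f t) - ∫ t, P t) := by ring
  rw [dist_eq_norm, h3]
  exact (norm_sub_le _ _).trans_lt (by linarith)

/-! ### Almost everywhere convergence -/

/-- The weak-type form of the maximal inequality, for all nonnegative functions in `L^p`. -/
theorem ChainControlled.exists_weak_const {n M v w : ℕ → ℕ} (h : ChainControlled n M v w)
    {p : ℝ} (hp : 1 < p) : ∃ A : ℝ, 0 ≤ A ∧ ∀ g : UnitAddCircle → ℝ, Measurable g →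
      (∀ x, 0 ≤ g x) → Integrable (fun x => g x ^ p) → ∀ ε : ℝ, 0 < ε →
        volume {x | ∃ t, ε < avg (n t) g x} ≤ ENNReal.ofReal (A * (∫ x, g x ^ p) / ε ^ p) := by
  have hp0 : 0 < p := by linarith
  obtain ⟨A, hA, hmax⟩ := h.exists_maximal_const hp
  refine ⟨A, hA, fun g hg hg0 hgi ε hε => ?_⟩
  set G : ℕ → UnitAddCircle → ℝ := fun T x => min (g x) T with hG
  have hGb : ∀ T, BddNonneg (G T) := fun T =>
    ⟨hg.min measurable_const, fun x => le_min (hg0 x) T.cast_nonneg, T, fun x => min_le_right _ _⟩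
  set S : ℕ → Set UnitAddCircle :=
    fun T => {x | ε < maxAvg ((Finset.range T).image n) (G T) x} with hS
  have hsub : {x | ∃ t, ε < avg (n t) g x} ⊆ ⋃ T, S T := by
    rintro x ⟨t, ht⟩
    -- a truncation level exceeding the finitely many values that enter the average
    obtain ⟨B, hB⟩ := exists_nat_ge (∑ k ∈ Finset.range (n t),
      g (x + (((k : ℝ) / (n t : ℝ) : ℝ) : UnitAddCircle)))
    refine Set.mem_iUnion.2 ⟨max B (t + 1), ?_⟩
    have heq : avg (n t) (G (max B (t + 1))) x = avg (n t) g x := by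
      simp only [avg]
      congr 1
      refine Finset.sum_congr rfl fun k hk => min_eq_left ?_
      refine (Finset.single_le_sum (f := fun k : ℕ =>
        g (x + (((k : ℝ) / (n t : ℝ) : ℝ) : UnitAddCircle))) (fun _ _ => hg0 _) hk).trans
          (hB.trans ?_)
      exact_mod_cast le_max_left B (t + 1)
    refine lt_of_lt_of_le (heq ▸ ht) (avg_le_maxAvg (Finset.mem_image_of_mem n ?_) _ x)
    exact Finset.mem_range.2 (lt_of_lt_of_le (Nat.lt_succ_self t) (le_max_right _ _))
  have hmono : Monotone S := by
    intro T T' hTT' x hx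
    refine lt_of_lt_of_le (b := maxAvg ((Finset.range T).image n) (G T) x) hx ?_
    rcases maxAvg_eq_zero_or ((Finset.range T).image n) (G T) x with h0 | ⟨a, ha, h0⟩
    · rw [h0]
      exact maxAvg_nonneg _ _ _
    · rw [h0]
      refine (avg_mono (fun y => ?_) x).trans (avg_le_maxAvg
        (Finset.image_subset_image (Finset.range_mono hTT') ha) _ x)
      exact min_le_min le_rfl (Nat.cast_le.2 hTT')
  refine (measure_mono hsub).trans ?_
  rw [hmono.measure_iUnion]
  refine iSup_le fun T => ?_
  have hb := ((hGb T).maxAvg (s := (Finset.range T).image n) fun a ha => by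
    obtain ⟨t, -, rfl⟩ := Finset.mem_image.1 ha
    exact h.n_pos t)
  have hmarkov := mul_meas_ge_le_integral_of_nonneg (ae_of_all volume (hb.rpow hp0.le).nonneg)
    (hb.rpow hp0.le).integrable (ε ^ p)
  have hle : ∫ x, G T x ^ p ≤ ∫ x, g x ^ p := integral_mono ((hGb T).rpow hp0.le).integrable hgi
    fun x => Real.rpow_le_rpow ((hGb T).nonneg x) (min_le_left _ _) hp0.le
  have hεp : 0 < ε ^ p := by positivity
  rw [← ofReal_measureReal]
  refine ENNReal.ofReal_le_ofReal ?_
  rw [le_div_iff₀ hεp, mul_comm]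
  refine (mul_le_mul_of_nonneg_left (measureReal_mono fun x hx => ?_) hεp.le).trans
    (hmarkov.trans ((hmax T _ (hGb T)).trans (mul_le_mul_of_nonneg_left hle hA)))
  exact Real.rpow_le_rpow hε.le (le_of_lt hx) hp0.le

/-- A dense class (the continuous functions) together with the weak-type inequality gives
convergence almost everywhere. -/
theorem ChainControlled.ae_tendsto_avg {n M v w : ℕ → ℕ} (h : ChainControlled n M v w)
    {p : ℝ} (hp : 1 < p) {f : UnitAddCircle → ℂ} (hfm : Measurable f)
    (hf : MemLp f (ENNReal.ofReal p)) :
    ∀ᵐ x ∂(volume : Measure UnitAddCircle),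
      Tendsto (fun k : ℕ => avg k f x) (atTop ⊓ 𝓟 (Set.range n)) (𝓝 (∫ t, f t)) := by
  have hp0 : 0 < p := by linarith
  have hpE : 1 ≤ ENNReal.ofReal p := by
    rw [← ENNReal.ofReal_one]
    exact ENNReal.ofReal_le_ofReal hp.le
  obtain ⟨A, hA, hweak⟩ := h.exists_weak_const hp
  have hnull : ∀ δ : ℝ, 0 < δ → ∀ᵐ x ∂(volume : Measure UnitAddCircle),
      ∀ᶠ k in atTop ⊓ 𝓟 (Set.range n), ‖avg k f x - ∫ t, f t‖ ≤ 3 * δ := by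
    intro δ hδ
    rw [ae_iff]
    have hbound : ∀ j : ℕ, volume {x | ¬ ∀ᶠ k in atTop ⊓ 𝓟 (Set.range n),
        ‖avg k f x - ∫ t, f t‖ ≤ 3 * δ} ≤ ENNReal.ofReal (A * (1 / ((j : ℝ) + 1)) ^ p) := by
      intro j
      set r : ℝ := 1 / ((j : ℝ) + 1) with hr
      have hr0 : 0 < r := by positivity
      have hr1 : r ≤ 1 := by
        rw [hr, div_le_one (by positivity)]
        have : (0 : ℝ) ≤ j := j.cast_nonneg
        linarith
      obtain ⟨φ, hφ, hφL⟩ := hf.exists_boundedContinuous_eLpNorm_sub_le ENNReal.ofReal_ne_top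
        (ε := ENNReal.ofReal (r * δ)) (by simpa using mul_pos hr0 hδ)
      have hdL : MemLp (f - ⇑φ) (ENNReal.ofReal p) := hf.sub hφL
      have hd1 : Integrable (f - ⇑φ) := hdL.integrable hpE
      have hgp : ∫ x, ‖(f - ⇑φ) x‖ ^ p ≤ (r * δ) ^ p := by
        rw [hdL.eLpNorm_eq_integral_rpow_norm (by simpa using hp0) ENNReal.ofReal_ne_top,
          ENNReal.ofReal_le_ofReal_iff (by positivity), ENNReal.toReal_ofReal hp0.le] at hφ
        have hI : 0 ≤ ∫ x, ‖(f - ⇑φ) x‖ ^ p := integral_nonneg fun x => by positivity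
        have := Real.rpow_le_rpow (by positivity) hφ hp0.le
        rwa [Real.rpow_inv_rpow hI hp0.ne'] at this
      have hg1 : ∫ x, ‖(f - ⇑φ) x‖ ≤ δ := by
        have h1 := (eLpNorm_le_eLpNorm_of_exponent_le hpE hdL.1).trans hφ
        rw [eLpNorm_one_eq_lintegral_enorm, ← ofReal_integral_norm_eq_lintegral_enorm hd1,
          ENNReal.ofReal_le_ofReal_iff (by positivity)] at h1
        nlinarith
      refine (measure_mono ?_).trans ((hweak (fun x => ‖(f - ⇑φ) x‖)
        (hfm.sub φ.continuous.measurable).norm (fun x => norm_nonneg _) ?_ δ hδ).trans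
          (ENNReal.ofReal_le_ofReal ?_))
      · intro x hx
        by_contra hcon
        simp only [Set.mem_ofPred_eq, not_exists, not_lt] at hcon
        refine hx ?_
        have hφt := tendsto_avg_continuousMap φ.toContinuousMap x
        have hev := (Metric.tendsto_nhds.1 hφt δ hδ).filter_mono
          (inf_le_left : atTop ⊓ 𝓟 (Set.range n) ≤ atTop)
        filter_upwards [hev, mem_inf_of_right (mem_principal_self (Set.range n))] with k hk hkn
        obtain ⟨t, rfl⟩ := hkn
        have h1 : ‖avg (n t) (f - ⇑φ) x‖ ≤ δ := (norm_avg_le _ _ x).trans (hcon t)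
        have h2 : ‖∫ y, (f - ⇑φ) y‖ ≤ δ := (norm_integral_le_integral_norm _).trans hg1
        rw [avg_sub, Pi.sub_apply] at h1
        have hφi : Integrable φ := integrable_continuousMap φ.toContinuousMap
        rw [integral_sub' (hf.integrable hpE) hφi] at h2
        rw [dist_eq_norm] at hk
        have hk' : ‖avg (n t) φ x - ∫ y, φ y‖ < δ := hk
        have h3 : avg (n t) f x - ∫ y, f y = (avg (n t) f x - avg (n t) φ x) +
            (avg (n t) φ x - ∫ y, φ y) - ((∫ y, f y) - ∫ y, φ y) := by ring
        rw [h3]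
        refine (norm_sub_le _ _).trans ?_
        have := norm_add_le (avg (n t) f x - avg (n t) φ x) (avg (n t) φ x - ∫ y, φ y)
        linarith
      · have := hdL.integrable_norm_rpow (by simpa using hp0) ENNReal.ofReal_ne_top
        rwa [ENNReal.toReal_ofReal hp0.le] at this
      · rw [div_le_iff₀ (by positivity), mul_assoc, ← Real.mul_rpow hr0.le hδ.le]
        gcongr
    have hlim : Tendsto (fun j : ℕ => ENNReal.ofReal (A * (1 / ((j : ℝ) + 1)) ^ p)) atTop
        (𝓝 0) := by
      have h1 := (tendsto_one_div_add_atTop_nhds_zero_nat (𝕜 := ℝ)).rpow_const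
        (p := p) (Or.inr hp0.le)
      rw [Real.zero_rpow hp0.ne'] at h1
      simpa using ENNReal.tendsto_ofReal (h1.const_mul A)
    exact le_antisymm (ge_of_tendsto' hlim hbound) bot_le
  have hall := ae_all_iff.2 fun j : ℕ => hnull (1 / ((j : ℝ) + 1)) (by positivity)
  filter_upwards [hall] with x hx
  rw [Metric.tendsto_nhds]
  intro ε hε
  obtain ⟨j, hj⟩ := exists_nat_one_div_lt (show 0 < ε / 3 by positivity)
  filter_upwards [hx j] with k hk
  rw [dist_eq_norm]
  linarith

theorem avg_congr_ae {f g : UnitAddCircle → ℂ} (hfg : f =ᵐ[volume] g) (n : ℕ) :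
    avg n f =ᵐ[volume] avg n g := by
  have h : ∀ c : UnitAddCircle, ∀ᵐ x ∂(volume : Measure UnitAddCircle), f (x + c) = g (x + c) :=
    fun c => (measurePreserving_add_right volume c).quasiMeasurePreserving.ae_eq_comp hfg
  have h' : ∀ᵐ x ∂(volume : Measure UnitAddCircle), ∀ k : ℕ,
      f (x + (((k : ℝ) / (n : ℝ) : ℝ) : UnitAddCircle)) =
        g (x + (((k : ℝ) / (n : ℝ) : ℝ) : UnitAddCircle)) := ae_all_iff.2 fun k => h _
  filter_upwards [h'] with x hx
  simp only [avg, hx]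

end RiemannSums

theorem mainTheorem2 :
    ∃ E : Set ℕ, (∀ n ∈ E, 0 < n) ∧ E.Infinite ∧ RiemannSums.dimension E = ⊤ ∧
      ∀ (p : ENNReal), 1 < p → ∀ f : UnitAddCircle → ℂ,
        MemLp f p (volume : Measure UnitAddCircle) →
          ∀ᵐ x ∂(volume : Measure UnitAddCircle),
            Tendsto (fun n : ℕ => RiemannSums.riemannSum n f x) (atTop ⊓ 𝓟 E)
              (𝓝 (∫ t : UnitAddCircle, f t)) := by
  refine ⟨Set.range RiemannSums.starNum, ?_, RiemannSums.infinite_range_starNum,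
    RiemannSums.dimension_range_starNum, fun p hp f hf => ?_⟩
  · rintro n ⟨t, rfl⟩
    exact RiemannSums.starNum_pos t
  obtain ⟨q, hq, hqp⟩ : ∃ q : ℝ, 1 < q ∧ ENNReal.ofReal q ≤ p := by
    rcases eq_or_ne p ⊤ with rfl | hp'
    · exact ⟨2, one_lt_two, le_top⟩
    · exact ⟨p.toReal, by simpa using (ENNReal.toReal_lt_toReal ENNReal.one_ne_top hp').2 hp,
        ENNReal.ofReal_toReal_le⟩
  have hfq : MemLp f (ENNReal.ofReal q) := hf.mono_exponent hqp
  -- `f` is only almost everywhere equal to a measurable function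
  have hae := hfq.1.aemeasurable.ae_eq_mk
  have hconv := RiemannSums.chainControlled_starNum.ae_tendsto_avg hq
    hfq.1.aemeasurable.measurable_mk (hfq.ae_eq hae)
  filter_upwards [hconv, ae_all_iff.2 (RiemannSums.avg_congr_ae hae)] with x hx hx'
  simp only [RiemannSums.riemannSum_eq_avg, hx', integral_congr_ae hae]
  exact hx
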